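/- Let $-\infty<a<b<\infty$, let $r>0$ and $p>0$ a.e. on $(a,b)$, let $q$ be real-valued, and let $r,\,1/p,\,q\in L^1((a,b);dx)$. Write $y^{[1]}=py'$ and $\tau y=r^{-1}\big(-(y^{[1]})'+qy\big)$. In $L^2((a,b);r\,dx)$ let $H_{\max}f=\tau f$ on the set of all $f\in L^2((a,b);r\,dx)$ with $f,f^{[1]}\in AC([a,b])$ and $\tau f\in L^2((a,b);r\,dx)$, and let $H_{\min}$ be the restriction of $H_{\max}$ to those $f$ with $f(a)=f^{[1]}(a)=f(b)=f^{[1]}(b)=0$. For $A,B\in\mathbb C^{2\times2}$ put $$\gamma_{A,B}(u)=A\binom{u(a)}{u^{[1]}(a)}-B\binom{u(b)}{u^{[1]}(b)},$$ and let $H_{A,B}$ be the restriction of $H_{\max}$ to $\{g\in\operatorname{dom}(H_{\max}):\gamma_{A,B}(g)=0\}$. Call $(A,B)$ a self-adjoint pair if $$\operatorname{rank}(A\ \ B)=2,\qquad AJA^*=BJB^*,\qquad J=\begin{pmatrix}0&-1\\1&0\end{pmatrix}.$$ Let $\mathcal N_\pm=\ker(H_{\max}\mp iI)$, with ordered bases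 $\{u_\pm,v_\pm\}$, and let $(A,B)$ be a self-adjoint pair. Then there is a unique linear isometric isomorphism $\mathcal U_{A,B}:\mathcal N_+\to\mathcal N_-$ such that $$\operatorname{dom}(H_{A,B})=\operatorname{dom}(H_{\min})\dotplus(I+\mathcal U_{A,B})\mathcal N_+$$ (direct sum). The matrix $(\gamma_{A,B}(u_-)\ \ \gamma_{A,B}(v_-))$ is invertible, and the matrix of $\mathcal U_{A,B}$ with respect to the bases $\{u_+,v_+\}$ and $\{u_-,v_-\}$ is $$[\mathcal U_{A,B}]=-\begin{pmatrix}\gamma_{A,B}(u_-)&\gamma_{A,B}(v_-)\end{pmatrix}^{-1}\begin{pmatrix}\gamma_{A,B}(u_+)&\gamma_{A,B}(v_+)\end{pmatrix}.$$ In particular, let $(A',B')$ be another self-adjoint pair, and suppose that $\gamma_{A',B'}(u_\pm)=\binom10$ and $\gamma_{A',B'}(v_\pm)=\binom01$. Then for $z=\pm i$ and every $c\in\mathbb C^2$ the boundary value problem $-(u^{[1]})'+qu=zru$ with $u,u^{[1]}\in AC([a,b])$ and $\gamma_{A',B'}(u)=c$ has exactly one solution $u_{A',B'}(z,\cdot\,;c)$.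 With the boundary data map $\Lambda_{A',B'}^{A,B}(z)\in\mathbb C^{2\times2}$ defined by $\Lambda_{A',B'}^{A,B}(z)\,c=\gamma_{A,B}\big(u_{A',B'}(z,\cdot\,;c)\big)$, the matrix $\Lambda_{A',B'}^{A,B}(-i)$ is invertible and $$[\mathcal U_{A,B}]=-\Lambda_{A',B'}^{A,B}(-i)^{-1}\,\Lambda_{A',B'}^{A,B}(i).$$ -/

import Mathlib

open MeasureTheory Set
open scoped Matrix

noncomputable section

/-- Coefficients of a regular three-coefficient Sturm--Liouville differential expression
`τ = r⁻¹ (-(d/dx) p (d/dx) + q)` on a bounded interval `(a, b)`: `r, p > 0` a.e. on `(a, b)`,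
`r, 1/p, q ∈ L¹((a, b); dx)`, and `q` is real-valued. -/
structure SturmLiouville where
  a : ℝ
  b : ℝ
  p : ℝ → ℝ
  q : ℝ → ℝ
  r : ℝ → ℝ
  hab : a < b
  r_pos : ∀ᵐ x ∂volume.restrict (Ioo a b), 0 < r x
  r_int : IntegrableOn r (Ioo a b)
  p_pos : ∀ᵐ x ∂volume.restrict (Ioo a b), 0 < p x
  p_inv_int : IntegrableOn (fun x => 1 / p x) (Ioo a b)
  q_int : IntegrableOn q (Ioo a b)

namespace SturmLiouville

variable (S : SturmLiouville)

/-- The measure `r dx` on `(a, b)`. -/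
def μ : Measure ℝ :=
  (volume.restrict (Ioo S.a S.b)).withDensity fun x => ENNReal.ofReal (S.r x)

/-- The Hilbert space `L²((a, b); r dx)`. -/
abbrev H : Type := Lp ℂ 2 S.μ

/-- `y` and `y1` are absolutely continuous on `[a, b]` and `y1` is the quasi-derivative
`y^{[1]} = p y'`. -/
structure IsQuasi (y y1 : ℝ → ℂ) : Prop where
  ac : AbsolutelyContinuousOnInterval y S.a S.b
  ac1 : AbsolutelyContinuousOnInterval y1 S.a S.b
  eq : ∀ᵐ x ∂volume.restrict (Ioo S.a S.b), y1 x = (S.p x : ℂ) * deriv y x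

/-- The function `τ y = r⁻¹ (-(y^{[1]})' + q y)`, where `y1 = y^{[1]}`. -/
def tau (y y1 : ℝ → ℂ) (x : ℝ) : ℂ :=
  (S.r x : ℂ)⁻¹ * (-deriv y1 x + (S.q x : ℂ) * y x)

/-- The class `f` is represented by a function `y` with `y, y1 = y^{[1]}` absolutely continuous on
`[a, b]` and `τ y ∈ L²((a, b); r dx)`. -/
structure IsRep (f : S.H) (y y1 : ℝ → ℂ) : Prop where
  quasi : S.IsQuasi y y1
  ae_eq : f =ᵐ[S.μ] y
  memLp : MemLp (S.tau y y1) 2 S.μ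

variable {S}

theorem ac_ae_differentiableAt {y : ℝ → ℂ} (h : AbsolutelyContinuousOnInterval y S.a S.b) :
    ∀ᵐ x ∂volume.restrict (Ioo S.a S.b), DifferentiableAt ℝ y x := by
  rw [ae_restrict_iff' measurableSet_Ioo]
  filter_upwards [h.boundedVariationOn.ae_differentiableAt_of_mem_uIcc] with x hx hm
  exact hx (by rw [uIcc_of_le S.hab.le]; exact Ioo_subset_Icc_self hm)

variable (S) in
theorem ae_iff_ae_vol {P : ℝ → Prop} :
    (∀ᵐ x ∂S.μ, P x) ↔ ∀ᵐ x ∂volume.restrict (Ioo S.a S.b), P x := by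
  rw [μ, ae_withDensity_iff' S.r_int.aemeasurable.ennreal_ofReal]
  constructor
  · intro h
    filter_upwards [h, S.r_pos] with x hx hr
    exact hx (by simpa using hr)
  · intro h
    filter_upwards [h] with x hx _
    exact hx

theorem eqOn_of_ae {y w : ℝ → ℂ} (hy : AbsolutelyContinuousOnInterval y S.a S.b)
    (hw : AbsolutelyContinuousOnInterval w S.a S.b)
    (h : ∀ᵐ x ∂volume.restrict (Ioo S.a S.b), y x = w x) : EqOn y w (Icc S.a S.b) := by
  have hy' := hy.continuousOn
  have hw' := hw.continuousOn
  rw [uIcc_of_le S.hab.le] at hy' hw'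
  refine Measure.eqOn_Icc_of_ae_eq volume S.hab.ne ?_ hy' hw'
  rw [← Measure.restrict_congr_set Ioo_ae_eq_Icc]
  exact h

/-- The quasi-derivative is determined on `[a, b]` by the function. -/
theorem IsQuasi.unique {y y1 w w1 : ℝ → ℂ} (hy : S.IsQuasi y y1) (hw : S.IsQuasi w w1)
    (h : ∀ᵐ x ∂volume.restrict (Ioo S.a S.b), y x = w x) :
    EqOn y w (Icc S.a S.b) ∧ EqOn y1 w1 (Icc S.a S.b) := by
  have h0 := eqOn_of_ae hy.ac hw.ac h
  refine ⟨h0, eqOn_of_ae hy.ac1 hw.ac1 ?_⟩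
  filter_upwards [hy.eq, hw.eq, ae_restrict_mem measurableSet_Ioo] with x h1 h2 hx
  have : y =ᶠ[nhds x] w :=
    Filter.mem_of_superset (isOpen_Ioo.mem_nhds hx) fun t ht => h0 (Ioo_subset_Icc_self ht)
  rw [h1, h2, this.deriv_eq]

theorem IsQuasi.add {y y1 w w1 : ℝ → ℂ} (hy : S.IsQuasi y y1) (hw : S.IsQuasi w w1) :
    S.IsQuasi (y + w) (y1 + w1) := by
  refine ⟨hy.ac.add hw.ac, hy.ac1.add hw.ac1, ?_⟩
  filter_upwards [hy.eq, hw.eq, ac_ae_differentiableAt hy.ac, ac_ae_differentiableAt hw.ac]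
    with x h1 h2 d1 d2
  rw [Pi.add_apply, h1, h2, deriv_add d1 d2]
  ring

theorem IsQuasi.smul {y y1 : ℝ → ℂ} (c : ℂ) (hy : S.IsQuasi y y1) :
    S.IsQuasi (c • y) (c • y1) := by
  refine ⟨hy.ac.const_smul c, hy.ac1.const_smul c, ?_⟩
  filter_upwards [hy.eq, ac_ae_differentiableAt hy.ac] with x h1 d1
  rw [Pi.smul_apply, h1, deriv_const_smul c d1, smul_eq_mul, smul_eq_mul]
  ring

theorem tau_add {y y1 w w1 : ℝ → ℂ} (hy : S.IsQuasi y y1) (hw : S.IsQuasi w w1) :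
    S.tau (y + w) (y1 + w1) =ᵐ[S.μ] S.tau y y1 + S.tau w w1 := by
  refine (ae_iff_ae_vol S).2 ?_
  filter_upwards [ac_ae_differentiableAt hy.ac1, ac_ae_differentiableAt hw.ac1] with x d1 d2
  simp only [tau, Pi.add_apply, deriv_add d1 d2]
  ring

theorem tau_smul {y y1 : ℝ → ℂ} (c : ℂ) (hy : S.IsQuasi y y1) :
    S.tau (c • y) (c • y1) =ᵐ[S.μ] c • S.tau y y1 := by
  refine (ae_iff_ae_vol S).2 ?_
  filter_upwards [ac_ae_differentiableAt hy.ac1] with x d1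
  simp only [tau, Pi.smul_apply, deriv_const_smul c d1, smul_eq_mul]
  ring

theorem IsRep.add {f g : S.H} {y y1 w w1 : ℝ → ℂ} (hf : S.IsRep f y y1) (hg : S.IsRep g w w1) :
    S.IsRep (f + g) (y + w) (y1 + w1) :=
  ⟨hf.quasi.add hg.quasi, (Lp.coeFn_add f g).trans (hf.ae_eq.add hg.ae_eq),
    (memLp_congr_ae (tau_add hf.quasi hg.quasi)).2 (hf.memLp.add hg.memLp)⟩

theorem IsRep.smul {f : S.H} {y y1 : ℝ → ℂ} (c : ℂ) (hf : S.IsRep f y y1) :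
    S.IsRep (c • f) (c • y) (c • y1) :=
  ⟨hf.quasi.smul c, (Lp.coeFn_smul c f).trans (hf.ae_eq.const_smul c),
    (memLp_congr_ae (tau_smul c hf.quasi)).2 (hf.memLp.const_smul c)⟩

theorem IsRep.unique {f : S.H} {y y1 w w1 : ℝ → ℂ} (h : S.IsRep f y y1) (h' : S.IsRep f w w1) :
    EqOn y w (Icc S.a S.b) ∧ EqOn y1 w1 (Icc S.a S.b) :=
  h.quasi.unique h'.quasi ((ae_iff_ae_vol S).1 (h.ae_eq.symm.trans h'.ae_eq))

theorem IsRep.tau_eq {f : S.H} {y y1 w w1 : ℝ → ℂ} (h : S.IsRep f y y1) (h' : S.IsRep f w w1) :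
    S.tau y y1 =ᵐ[S.μ] S.tau w w1 := by
  obtain ⟨h0, h1⟩ := h.unique h'
  refine (ae_iff_ae_vol S).2 ?_
  filter_upwards [ae_restrict_mem measurableSet_Ioo] with x hx
  have : y1 =ᶠ[nhds x] w1 :=
    Filter.mem_of_superset (isOpen_Ioo.mem_nhds hx) fun t ht => h1 (Ioo_subset_Icc_self ht)
  rw [tau, tau, this.deriv_eq, h0 (Ioo_subset_Icc_self hx)]

theorem isRep_zero : S.IsRep 0 0 0 := by
  have ac0 : AbsolutelyContinuousOnInterval (0 : ℝ → ℂ) S.a S.b :=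
    ((LipschitzWith.const (0 : ℂ)).lipschitzOnWith (s := uIcc S.a S.b)).absolutelyContinuousOnInterval
  have hz : S.tau 0 0 = 0 := by
    funext x
    have : deriv (0 : ℝ → ℂ) x = 0 := deriv_const x (0 : ℂ)
    simp [tau, this]
  refine ⟨⟨ac0, ac0, ?_⟩, Lp.coeFn_zero ℂ 2 S.μ, ?_⟩
  · refine Filter.Eventually.of_forall fun x => ?_
    have : deriv (0 : ℝ → ℂ) x = 0 := deriv_const x (0 : ℂ)
    simp [this]
  · rw [hz]
    exact MemLp.zero

variable (S)

/-- `dom(H_max)`. -/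
def maxDomain : Submodule ℂ S.H where
  carrier := {f | ∃ y y1 : ℝ → ℂ, S.IsRep f y y1}
  zero_mem' := ⟨0, 0, isRep_zero⟩
  add_mem' := by
    rintro f g ⟨y, y1, h⟩ ⟨w, w1, h'⟩
    exact ⟨_, _, h.add h'⟩
  smul_mem' := by
    rintro c f ⟨y, y1, h⟩
    exact ⟨_, _, h.smul c⟩

variable {S} in
/-- The representative of `f ∈ dom(H_max)` that is absolutely continuous on `[a, b]` (unique
there by `IsRep.unique`). -/
def rep (f : S.maxDomain) : ℝ → ℂ := f.2.choose

variable {S} in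
/-- The quasi-derivative of the absolutely continuous representative of `f ∈ dom(H_max)`. -/
def rep1 (f : S.maxDomain) : ℝ → ℂ := f.2.choose_spec.choose

variable {S} in
theorem isRep_rep (f : S.maxDomain) : S.IsRep f (rep f) (rep1 f) := f.2.choose_spec.choose_spec

/-- The maximal operator `H_max f = τ f` in `L²((a, b); r dx)`. -/
def Hmax : S.H →ₗ.[ℂ] S.H where
  domain := S.maxDomain
  toFun :=
    { toFun := fun f => (isRep_rep f).memLp.toLp _
      map_add' := fun f g => by
        rw [← MemLp.toLp_add]
        exact (MemLp.toLp_eq_toLp_iff _ _).2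
          (((isRep_rep (f + g)).tau_eq ((isRep_rep f).add (isRep_rep g))).trans
            (tau_add (isRep_rep f).quasi (isRep_rep g).quasi))
      map_smul' := fun c f => by
        rw [RingHom.id_apply, ← MemLp.toLp_const_smul]
        exact (MemLp.toLp_eq_toLp_iff _ _).2
          (((isRep_rep (c • f)).tau_eq ((isRep_rep f).smul c)).trans
            (tau_smul c (isRep_rep f).quasi)) }

/-- Boundary values `(f(x), f^{[1]}(x))` of `f ∈ dom(H_max)` at a point `x ∈ [a, b]`. -/
def bdryVal (x : ℝ) (hx : x ∈ Icc S.a S.b) : S.Hmax.domain →ₗ[ℂ] (Fin 2 → ℂ) where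
  toFun f := ![rep f x, rep1 f x]
  map_add' f g := by
    obtain ⟨h0, h1⟩ := (isRep_rep (f + g)).unique ((isRep_rep f).add (isRep_rep g))
    ext i
    fin_cases i
    · exact h0 hx
    · exact h1 hx
  map_smul' c f := by
    obtain ⟨h0, h1⟩ := (isRep_rep (c • f)).unique ((isRep_rep f).smul c)
    ext i
    fin_cases i
    · exact h0 hx
    · exact h1 hx

/-- `(f(a), f^{[1]}(a))`. -/
def bdryA : S.Hmax.domain →ₗ[ℂ] (Fin 2 → ℂ) := S.bdryVal S.a (left_mem_Icc.2 S.hab.le)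

/-- `(f(b), f^{[1]}(b))`. -/
def bdryB : S.Hmax.domain →ₗ[ℂ] (Fin 2 → ℂ) := S.bdryVal S.b (right_mem_Icc.2 S.hab.le)

/-- The general boundary trace map `γ_{A,B}` for a function `y` with quasi-derivative `y1`. -/
def trace (A B : Matrix (Fin 2) (Fin 2) ℂ) (y y1 : ℝ → ℂ) : Fin 2 → ℂ :=
  A *ᵥ ![y S.a, y1 S.a] - B *ᵥ ![y S.b, y1 S.b]

/-- The general boundary trace map `γ_{A,B}` on `dom(H_max)`. -/
def gamma (A B : Matrix (Fin 2) (Fin 2) ℂ) : S.Hmax.domain →ₗ[ℂ] (Fin 2 → ℂ) :=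
  A.mulVecLin ∘ₗ S.bdryA - B.mulVecLin ∘ₗ S.bdryB

variable {S} in
/-- The trace of a class can be computed from any of its absolutely continuous representatives. -/
theorem gamma_eq_trace (A B : Matrix (Fin 2) (Fin 2) ℂ) (f : S.Hmax.domain) {y y1 : ℝ → ℂ}
    (h : S.IsRep f y y1) : S.gamma A B f = S.trace A B y y1 := by
  obtain ⟨h0, h1⟩ := (isRep_rep f).unique h
  have ha := left_mem_Icc.2 S.hab.le
  have hb := right_mem_Icc.2 S.hab.le
  simp only [gamma, trace, bdryA, bdryB, bdryVal, LinearMap.sub_apply, LinearMap.comp_apply,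
    LinearMap.coe_mk, AddHom.coe_mk, Matrix.mulVecLin_apply]
  rw [h0 ha, h1 ha, h0 hb, h1 hb]

/-- The minimal operator `H_min`. -/
def Hmin : S.H →ₗ.[ℂ] S.H :=
  S.Hmax.domRestrict ((LinearMap.ker S.bdryA ⊓ LinearMap.ker S.bdryB).map S.Hmax.domain.subtype)

/-- The extension `H_{A,B}` of `H_min`: the restriction of `H_max` to `{g | γ_{A,B} g = 0}`. -/
def HAB (A B : Matrix (Fin 2) (Fin 2) ℂ) : S.H →ₗ.[ℂ] S.H :=
  S.Hmax.domRestrict ((LinearMap.ker (S.gamma A B)).map S.Hmax.domain.subtype)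

/-- `ker(H_max - z I)`, a subspace of `L²((a, b); r dx)`. -/
def defect (z : ℂ) : Submodule ℂ S.H :=
  (LinearMap.ker (S.Hmax.toFun - z • S.Hmax.domain.subtype)).map S.Hmax.domain.subtype

theorem defect_le (z : ℂ) : S.defect z ≤ S.Hmax.domain := Submodule.map_subtype_le _ _

/-- `𝒩₊ = ker(H_max - i I)`. -/
abbrev Npos : Submodule ℂ S.H := S.defect Complex.I

/-- `𝒩₋ = ker(H_max + i I)`. -/
abbrev Nneg : Submodule ℂ S.H := S.defect (-Complex.I)

/-- The trace map `γ_{A,B}` on `ker(H_max - z I)`. -/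
def gammaKer (A B : Matrix (Fin 2) (Fin 2) ℂ) {z : ℂ} (w : S.defect z) : Fin 2 → ℂ :=
  S.gamma A B (Submodule.inclusion (S.defect_le z) w)

/-- The matrix `(γ_{A,B}(u) γ_{A,B}(v))` whose columns are the traces of `u = w 0`, `v = w 1`. -/
def traceMatrix (A B : Matrix (Fin 2) (Fin 2) ℂ) {z : ℂ} (w : Fin 2 → S.defect z) :
    Matrix (Fin 2) (Fin 2) ℂ :=
  Matrix.of fun i j => S.gammaKer A B (w j) i

/-- The subspace `{f + U f | f ∈ 𝒩₊}` of `L²((a, b); r dx)`. -/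
def vonNeumannSpace (U : S.Npos ≃ₗᵢ[ℂ] S.Nneg) : Submodule ℂ S.H :=
  LinearMap.range (S.Npos.subtype + S.Nneg.subtype ∘ₗ U.toLinearEquiv.toLinearMap)

/-- `U : 𝒩₊ → 𝒩₋` is von Neumann's unitary for `H_{A,B}`:
`dom(H_{A,B})` is the direct sum of `dom(H_min)` and `(I + U) 𝒩₊`. -/
def IsVonNeumannUnitary (A B : Matrix (Fin 2) (Fin 2) ℂ) (U : S.Npos ≃ₗᵢ[ℂ] S.Nneg) : Prop :=
  Disjoint S.Hmin.domain (S.vonNeumannSpace U) ∧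
    (S.HAB A B).domain = S.Hmin.domain ⊔ S.vonNeumannSpace U

/-- `y` (with quasi-derivative `y1`) solves the boundary value problem
`-(y^{[1]})' + q y = z r y`, `γ_{A,B} y = c`. -/
structure SolvesBVP (A B : Matrix (Fin 2) (Fin 2) ℂ) (z : ℂ) (c : Fin 2 → ℂ)
    (y y1 : ℝ → ℂ) : Prop where
  quasi : S.IsQuasi y y1
  eqn : ∀ᵐ x ∂volume.restrict (Ioo S.a S.b),
    -deriv y1 x + (S.q x : ℂ) * y x = z * (S.r x : ℂ) * y x
  bc : S.trace A B y y1 = c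

/-- For every `c ∈ ℂ²` the boundary value problem has exactly one solution on `[a, b]`. -/
def BVPUniquelySolvable (A B : Matrix (Fin 2) (Fin 2) ℂ) (z : ℂ) : Prop :=
  ∀ c : Fin 2 → ℂ, (∃ y y1 : ℝ → ℂ, S.SolvesBVP A B z c y y1) ∧
    ∀ y y1 w w1 : ℝ → ℂ, S.SolvesBVP A B z c y y1 → S.SolvesBVP A B z c w w1 →
      EqOn y w (Icc S.a S.b)

/-- The solution `u_{A,B}(z, · ; c)` of the boundary value problem with its quasi-derivative
(meaningful whenever the problem is uniquely solvable, in particular for `z` in the resolvent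
set of `H_{A,B}`). -/
def bvpSol (A B : Matrix (Fin 2) (Fin 2) ℂ) (z : ℂ) (c : Fin 2 → ℂ) : (ℝ → ℂ) × (ℝ → ℂ) :=
  Classical.epsilon fun u => S.SolvesBVP A B z c u.1 u.2

/-- The general boundary data map `Λ_{A',B'}^{A,B}(z) : c ↦ γ_{A,B}(u_{A',B'}(z, · ; c))`, as a
matrix: its columns are the images of the standard basis vectors. -/
def boundaryDataMap (A' B' A B : Matrix (Fin 2) (Fin 2) ℂ) (z : ℂ) : Matrix (Fin 2) (Fin 2) ℂ :=
  Matrix.of fun i j =>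
    S.trace A B (S.bvpSol A' B' z (Pi.single j 1)).1 (S.bvpSol A' B' z (Pi.single j 1)).2 i

theorem trace_add (A B : Matrix (Fin 2) (Fin 2) ℂ) (y y1 w w1 : ℝ → ℂ) :
    S.trace A B (y + w) (y1 + w1) = S.trace A B y y1 + S.trace A B w w1 := by
  ext i
  fin_cases i <;> simp [trace] <;> ring

theorem trace_smul (A B : Matrix (Fin 2) (Fin 2) ℂ) (k : ℂ) (y y1 : ℝ → ℂ) :
    S.trace A B (k • y) (k • y1) = k • S.trace A B y y1 := by
  ext i
  fin_cases i <;> simp [trace] <;> ring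

variable {S} in
theorem SolvesBVP.add {A B : Matrix (Fin 2) (Fin 2) ℂ} {z : ℂ} {c d : Fin 2 → ℂ}
    {y y1 w w1 : ℝ → ℂ} (h : S.SolvesBVP A B z c y y1) (h' : S.SolvesBVP A B z d w w1) :
    S.SolvesBVP A B z (c + d) (y + w) (y1 + w1) := by
  refine ⟨h.quasi.add h'.quasi, ?_, by rw [trace_add, h.bc, h'.bc]⟩
  filter_upwards [h.eqn, h'.eqn, ac_ae_differentiableAt h.quasi.ac1,
    ac_ae_differentiableAt h'.quasi.ac1] with x e1 e2 d1 d2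
  simp only [Pi.add_apply, deriv_add d1 d2]
  linear_combination e1 + e2

variable {S} in
theorem SolvesBVP.smul {A B : Matrix (Fin 2) (Fin 2) ℂ} {z : ℂ} {c : Fin 2 → ℂ}
    {y y1 : ℝ → ℂ} (k : ℂ) (h : S.SolvesBVP A B z c y y1) :
    S.SolvesBVP A B z (k • c) (k • y) (k • y1) := by
  refine ⟨h.quasi.smul k, ?_, by rw [trace_smul, h.bc]⟩
  filter_upwards [h.eqn, ac_ae_differentiableAt h.quasi.ac1] with x e1 d1
  simp only [Pi.smul_apply, deriv_const_smul k d1, smul_eq_mul]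
  linear_combination k * e1

variable {S} in
/-- The matrix `Λ_{A',B'}^{A,B}(z)` sends `c = γ_{A',B'}(u)` to `γ_{A,B}(u)` for every solution
`u` of the boundary value problem, whenever that problem is uniquely solvable. -/
theorem boundaryDataMap_mulVec {A' B' : Matrix (Fin 2) (Fin 2) ℂ} {z : ℂ}
    (hz : S.BVPUniquelySolvable A' B' z) (A B : Matrix (Fin 2) (Fin 2) ℂ) {c : Fin 2 → ℂ}
    {y y1 : ℝ → ℂ} (h : S.SolvesBVP A' B' z c y y1) :
    S.boundaryDataMap A' B' A B z *ᵥ c = S.trace A B y y1 := by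
  have hs : ∀ d, S.SolvesBVP A' B' z d (S.bvpSol A' B' z d).1 (S.bvpSol A' B' z d).2 := by
    intro d
    obtain ⟨w, w1, hw⟩ := (hz d).1
    exact Classical.epsilon_spec (p := fun u : (ℝ → ℂ) × (ℝ → ℂ) =>
      S.SolvesBVP A' B' z d u.1 u.2) ⟨(w, w1), hw⟩
  have hc := ((hs (Pi.single 0 1)).smul (c 0)).add ((hs (Pi.single 1 1)).smul (c 1))
  have hcc : c 0 • (Pi.single 0 1 : Fin 2 → ℂ) + c 1 • (Pi.single 1 1 : Fin 2 → ℂ) = c := by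
    ext i
    fin_cases i <;> simp
  rw [hcc] at hc
  have h0 := (hz c).2 _ _ _ _ h hc
  have h1 := (h.quasi.unique hc.quasi (by
    filter_upwards [ae_restrict_mem measurableSet_Ioo] with x hx
    exact h0 (Ioo_subset_Icc_self hx))).2
  have ha := left_mem_Icc.2 S.hab.le
  have hb := right_mem_Icc.2 S.hab.le
  rw [trace, h0 ha, h1 ha, h0 hb, h1 hb, ← trace, trace_add, trace_smul, trace_smul]
  ext i
  simp only [boundaryDataMap, Matrix.mulVec, dotProduct, Fin.sum_univ_two, Matrix.of_apply,
    Pi.add_apply, Pi.smul_apply, smul_eq_mul]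
  ring

end SturmLiouville

/-- `rank (A B) = 2` and `A J A* = B J B*` with `J = (0 -1; 1 0)`. -/
def IsSelfAdjointPair (A B : Matrix (Fin 2) (Fin 2) ℂ) : Prop :=
  (Matrix.fromCols A B).rank = 2 ∧
    A * !![0, -1; 1, 0] * Aᴴ = B * !![0, -1; 1, 0] * Bᴴ

end

/-! Green's formula (`inner_Hmax_sub_inner`) turns the asymmetry of `H_max` into a boundary form. On
`𝒩₊ × 𝒩₋` that form is `-2i(⟨f₊,g₊⟩ - ⟨f₋,g₋⟩)`, which is nondegenerate, so boundary values
determine `(f₊, f₋)` (`defectBdry_injective`). Both sides have dimension 4, hence every set of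
boundary values is attained: modulo `dom(H_min)`, `dom(H_max)` is `𝒩₊ ∔ 𝒩₋`.

For a self-adjoint pair the boundary condition cuts out a Lagrangian subspace
(`wronskian_eq_of_isSelfAdjointPair`), so `γ(f₊ + f₋) = 0` forces `‖f₊‖ = ‖f₋‖`. Thus `γ` is
injective, hence bijective, on each of `𝒩₊` and `𝒩₋`, and `U = -(γ|𝒩₋)⁻¹ γ|𝒩₊` is the isometry
sought; in bases this is the matrix formula. When the bases have standard `γ_{A',B'}` traces, the
boundary data maps at `±i` are exactly the trace matrices. -/

/-! ### Calculus of complex-valued absolutely continuous functions. -/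

theorem AbsolutelyContinuousOnInterval.of_dist_le {X Y : Type*} [PseudoMetricSpace X]
    [PseudoMetricSpace Y] {f : ℝ → X} {g : ℝ → Y} {a b : ℝ}
    (hf : AbsolutelyContinuousOnInterval f a b) (h : ∀ x y, dist (g x) (g y) ≤ dist (f x) (f y)) :
    AbsolutelyContinuousOnInterval g a b :=
  squeeze_zero (fun _ => Finset.sum_nonneg fun _ _ => dist_nonneg)
    (fun _ => Finset.sum_le_sum fun _ _ => h _ _) hf

theorem AbsolutelyContinuousOnInterval.re {F : ℝ → ℂ} {a b : ℝ}
    (hF : AbsolutelyContinuousOnInterval F a b) :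
    AbsolutelyContinuousOnInterval (fun x => (F x).re) a b :=
  hF.of_dist_le fun x y => by
    rw [Real.dist_eq, dist_eq_norm, ← Complex.sub_re]
    exact Complex.abs_re_le_norm _

theorem AbsolutelyContinuousOnInterval.im {F : ℝ → ℂ} {a b : ℝ}
    (hF : AbsolutelyContinuousOnInterval F a b) :
    AbsolutelyContinuousOnInterval (fun x => (F x).im) a b :=
  hF.of_dist_le fun x y => by
    rw [Real.dist_eq, dist_eq_norm, ← Complex.sub_im]
    exact Complex.abs_im_le_norm _

theorem AbsolutelyContinuousOnInterval.conj {F : ℝ → ℂ} {a b : ℝ}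
    (hF : AbsolutelyContinuousOnInterval F a b) :
    AbsolutelyContinuousOnInterval (fun x => star (F x)) a b :=
  hF.of_dist_le fun x y => by
    rw [dist_eq_norm, dist_eq_norm, ← star_sub, norm_star]

/-- The fundamental theorem of calculus for complex-valued absolutely continuous functions. -/
theorem AbsolutelyContinuousOnInterval.integral_complex_eq_sub {F F' : ℝ → ℂ} {a b : ℝ}
    (hab : a ≤ b) (hF : AbsolutelyContinuousOnInterval F a b)
    (hF' : ∀ᵐ x ∂volume.restrict (Ioo a b), HasDerivAt F (F' x) x)
    (hi : IntegrableOn F' (Ioo a b)) :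
    ∫ x in Ioo a b, F' x = F b - F a := by
  have hre : ∫ x in Ioo a b, (F' x).re = (F b).re - (F a).re := by
    rw [← hF.re.integral_deriv_eq_sub, intervalIntegral.integral_of_le hab,
      integral_Ioc_eq_integral_Ioo]
    refine integral_congr_ae ?_
    filter_upwards [hF'] with x hx
    exact ((Complex.reCLM.hasFDerivAt.comp_hasDerivAt x hx).deriv).symm
  have him : ∫ x in Ioo a b, (F' x).im = (F b).im - (F a).im := by
    rw [← hF.im.integral_deriv_eq_sub, intervalIntegral.integral_of_le hab,
      integral_Ioc_eq_integral_Ioo]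
    refine integral_congr_ae ?_
    filter_upwards [hF'] with x hx
    exact ((Complex.imCLM.hasFDerivAt.comp_hasDerivAt x hx).deriv).symm
  refine Complex.ext ?_ ?_
  · rw [Complex.sub_re, ← hre]
    exact (Complex.reCLM.integral_comp_comm hi).symm
  · rw [Complex.sub_im, ← him]
    exact (Complex.imCLM.integral_comp_comm hi).symm

/-! ### Green's formula. -/

namespace SturmLiouville

variable (S : SturmLiouville)

theorem IsQuasi.ac_wronskian {S : SturmLiouville} {y y1 w w1 : ℝ → ℂ} (hy : S.IsQuasi y y1)
    (hw : S.IsQuasi w w1) :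
    AbsolutelyContinuousOnInterval (fun x => star (y x) * w1 x - star (y1 x) * w x) S.a S.b :=
  (hy.ac.conj.smul hw.ac1).sub (hy.ac1.conj.smul hw.ac)

/-- Since `p` is real, the cross terms `star y' * w1` and `star y1 * w'` both equal `p * star y' *
w'` and cancel. -/
theorem IsQuasi.hasDerivAt_wronskian {S : SturmLiouville} {y y1 w w1 : ℝ → ℂ}
    (hy : S.IsQuasi y y1) (hw : S.IsQuasi w w1) :
    ∀ᵐ x ∂volume.restrict (Ioo S.a S.b),
      HasDerivAt (fun x => star (y x) * w1 x - star (y1 x) * w x)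
        (star (y x) * deriv w1 x - star (deriv y1 x) * w x) x := by
  filter_upwards [hy.eq, hw.eq, ac_ae_differentiableAt hy.ac, ac_ae_differentiableAt hy.ac1,
    ac_ae_differentiableAt hw.ac, ac_ae_differentiableAt hw.ac1] with x ey ew dy dy1 dw dw1
  have h := (dy.hasDerivAt.star.mul dw1.hasDerivAt).sub (dy1.hasDerivAt.star.mul dw.hasDerivAt)
  refine h.congr_deriv ?_
  have e1 : star (y1 x) = (S.p x : ℂ) * star (deriv y x) := by
    rw [ey, star_mul', Complex.star_def, Complex.conj_ofReal]
  rw [e1, ew]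
  ring

theorem integrable_mu_iff {g : ℝ → ℂ} :
    Integrable g S.μ ↔ IntegrableOn (fun x => S.r x * g x) (Ioo S.a S.b) := by
  rw [μ, integrable_withDensity_iff_integrable_smul₀' S.r_int.aemeasurable.ennreal_ofReal
    (Filter.Eventually.of_forall fun _ => ENNReal.ofReal_lt_top)]
  refine integrable_congr ?_
  filter_upwards [S.r_pos] with x hx
  simp [ENNReal.toReal_ofReal hx.le]

theorem integral_mu (g : ℝ → ℂ) :
    ∫ x, g x ∂S.μ = ∫ x in Ioo S.a S.b, S.r x * g x := by
  rw [μ, integral_withDensity_eq_integral_toReal_smul₀ S.r_int.aemeasurable.ennreal_ofReal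
    (Filter.Eventually.of_forall fun _ => ENNReal.ofReal_lt_top)]
  refine integral_congr_ae ?_
  filter_upwards [S.r_pos] with x hx
  simp [ENNReal.toReal_ofReal hx.le]

/-- The boundary form `conj f(x) g^{[1]}(x) - conj f^{[1]}(x) g(x)` of two vectors of boundary
values. -/
noncomputable def wronskian (ξ η : Fin 2 → ℂ) : ℂ := star (ξ 0) * η 1 - star (ξ 1) * η 0

/-- Green's formula. -/
theorem inner_Hmax_sub_inner (f g : S.Hmax.domain) :
    inner ℂ (S.Hmax f) (g : S.H) - inner ℂ (f : S.H) (S.Hmax g) =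
      wronskian (S.bdryB f) (S.bdryB g) - wronskian (S.bdryA f) (S.bdryA g) := by
  have hf := isRep_rep f
  have hg := isRep_rep g
  have hHf : S.Hmax f =ᵐ[S.μ] S.tau (rep f) (rep1 f) := MemLp.coeFn_toLp hf.memLp
  have hHg : S.Hmax g =ᵐ[S.μ] S.tau (rep g) (rep1 g) := MemLp.coeFn_toLp hg.memLp
  have i1 := L2.integrable_inner (𝕜 := ℂ) (S.Hmax f) (g : S.H)
  have i2 := L2.integrable_inner (𝕜 := ℂ) (f : S.H) (S.Hmax g)
  -- The weight `r` cancels the `r⁻¹` in `τ`, and the `q` terms cancel because `q` is real.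
  have key : (fun x => (S.r x : ℂ) * (inner ℂ ((S.Hmax f : S.H) x) ((g : S.H) x) -
      inner ℂ ((f : S.H) x) ((S.Hmax g : S.H) x))) =ᵐ[volume.restrict (Ioo S.a S.b)]
      fun x => star (rep f x) * deriv (rep1 g) x - star (deriv (rep1 f) x) * rep g x := by
    filter_upwards [(ae_iff_ae_vol S).1 hHf, (ae_iff_ae_vol S).1 hHg,
      (ae_iff_ae_vol S).1 hf.ae_eq, (ae_iff_ae_vol S).1 hg.ae_eq, S.r_pos] with x e1 e2 e3 e4 hr
    have hr' : (S.r x : ℂ) ≠ 0 := by exact_mod_cast hr.ne'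
    rw [e1, e2, e3, e4]
    simp only [RCLike.inner_apply, tau, map_mul, map_add, map_neg, map_inv₀, Complex.conj_ofReal,
      Complex.star_def]
    field_simp
    ring
  -- Integrability of the Wronskian's derivative is inherited through `key` from that of the `L²`
  -- inner products.
  rw [L2.inner_def, L2.inner_def, ← integral_sub i1 i2, integral_mu, integral_congr_ae key,
    AbsolutelyContinuousOnInterval.integral_complex_eq_sub S.hab.le
      (hf.quasi.ac_wronskian hg.quasi) (hf.quasi.hasDerivAt_wronskian hg.quasi)
      (((S.integrable_mu_iff).1 (i1.sub i2)).congr key)]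
  rfl

end SturmLiouville

/-! ### Linear algebra of self-adjoint pairs. -/

open scoped ComplexOrder in
/-- The kernel of `(A -B)` is parametrized by `c ↦ (J A* c, J B* c)` for a self-adjoint pair. -/
theorem IsSelfAdjointPair.exists_eq_mulVec {A B : Matrix (Fin 2) (Fin 2) ℂ}
    (h : IsSelfAdjointPair A B) {ξ η : Fin 2 → ℂ} (hξη : A *ᵥ ξ = B *ᵥ η) :
    ∃ c, ξ = !![0, -1; 1, 0] *ᵥ (Aᴴ *ᵥ c) ∧ η = !![0, -1; 1, 0] *ᵥ (Bᴴ *ᵥ c) := by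
  set J : Matrix (Fin 2) (Fin 2) ℂ := !![0, -1; 1, 0] with hJ
  have hdet : IsUnit J.det := by simp [hJ, Matrix.det_fin_two]
  have hD : IsUnit (Matrix.fromBlocks J 0 0 (-J)).det := by
    rw [Matrix.det_fromBlocks_zero₂₁, Matrix.det_neg]
    exact hdet.mul (by simpa using hdet)
  set M := Matrix.fromCols A B with hM
  -- The range of `N` consists of the vectors `(J A* c, -J B* c)`. The condition `A J A* = B J B*`
  -- says `M N = 0`, and `range N = ker M` because both have dimension 2 in `ℂ⁴`.
  set N := Matrix.fromBlocks J 0 0 (-J) * Mᴴ with hN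
  have hNrank : N.rank = 2 := by
    rw [hN, Matrix.rank_mul_eq_right_of_isUnit_det _ _ hD, Matrix.rank_conjTranspose, h.1]
  have hNeq : N = Matrix.fromRows (J * Aᴴ) (-(J * Bᴴ)) := by
    rw [hN, hM, Matrix.conjTranspose_fromCols_eq_fromRows_conjTranspose,
      ← Matrix.fromCols_fromRows_eq_fromBlocks, Matrix.fromCols_mul_fromRows]
    ext i j
    rcases i with i | i <;> simp [Matrix.fromRows_mul]
  have hMN : M * N = 0 := by
    rw [hNeq, hM, Matrix.fromCols_mul_fromRows, Matrix.mul_neg, ← Matrix.mul_assoc,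
      ← Matrix.mul_assoc, h.2, add_neg_cancel]
  have hle : LinearMap.range N.mulVecLin ≤ LinearMap.ker M.mulVecLin := by
    rintro _ ⟨c, rfl⟩
    simp [hMN]
  have hker : Module.finrank ℂ (LinearMap.ker M.mulVecLin) = 2 := by
    have := LinearMap.finrank_range_add_finrank_ker M.mulVecLin
    have hr : Module.finrank ℂ (LinearMap.range M.mulVecLin) = 2 := h.1
    rw [hr] at this
    simp at this
    omega
  have heq := Submodule.eq_of_le_of_finrank_eq hle (by rw [hker]; exact hNrank)
  have hmem : Sum.elim ξ (-η) ∈ LinearMap.ker M.mulVecLin := by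
    rw [LinearMap.mem_ker, Matrix.mulVecLin_apply, hM, Matrix.fromCols_mulVec]
    simp [Matrix.mulVec_neg, hξη]
  rw [← heq] at hmem
  obtain ⟨c, hc⟩ := hmem
  rw [Matrix.mulVecLin_apply, hNeq, Matrix.fromRows_mulVec, Sum.elim_eq_iff] at hc
  refine ⟨c, by rw [← hc.1, Matrix.mulVec_mulVec], ?_⟩
  rw [← neg_neg η, ← hc.2, Matrix.neg_mulVec, neg_neg, Matrix.mulVec_mulVec]

namespace SturmLiouville

/-- The boundary form is `-ξ* J η`, and `J* J = 1` absorbs the two outer factors. -/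
theorem wronskian_mulVec (A : Matrix (Fin 2) (Fin 2) ℂ) (c d : Fin 2 → ℂ) :
    wronskian (!![0, -1; 1, 0] *ᵥ (Aᴴ *ᵥ c)) (!![0, -1; 1, 0] *ᵥ (Aᴴ *ᵥ d)) =
      -(star c ⬝ᵥ ((A * !![0, -1; 1, 0] * Aᴴ) *ᵥ d)) := by
  simp [wronskian, Matrix.mulVec, dotProduct, Fin.sum_univ_two, Matrix.mul_apply]
  ring

theorem wronskian_eq_of_isSelfAdjointPair {A B : Matrix (Fin 2) (Fin 2) ℂ}
    (h : IsSelfAdjointPair A B) {ξ η ξ' η' : Fin 2 → ℂ} (h1 : A *ᵥ ξ = B *ᵥ η)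
    (h2 : A *ᵥ ξ' = B *ᵥ η') : wronskian η η' = wronskian ξ ξ' := by
  obtain ⟨c, rfl, rfl⟩ := h.exists_eq_mulVec h1
  obtain ⟨d, rfl, rfl⟩ := h.exists_eq_mulVec h2
  rw [wronskian_mulVec, wronskian_mulVec, h.2]

/-! ### Boundary values on the defect spaces. -/

variable (S : SturmLiouville)

/-- The inclusion of a defect space into `dom(H_max)`. -/
noncomputable abbrev defectIncl (z : ℂ) : S.defect z →ₗ[ℂ] S.Hmax.domain :=
  Submodule.inclusion (S.defect_le z)

theorem mem_defect_iff (z : ℂ) (f : S.Hmax.domain) :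
    (f : S.H) ∈ S.defect z ↔ S.Hmax f = z • (f : S.H) := by
  constructor
  · rintro ⟨g, hg, hgf⟩
    obtain rfl : g = f := Subtype.ext hgf
    exact sub_eq_zero.1 hg
  · intro h
    exact ⟨f, sub_eq_zero.2 h, rfl⟩

theorem Hmax_defectIncl (z : ℂ) (w : S.defect z) :
    S.Hmax (S.defectIncl z w) = z • (w : S.H) :=
  (S.mem_defect_iff z (S.defectIncl z w)).1 w.2

/-- The sum `f₊ + f₋` as an element of `dom(H_max)`. -/
noncomputable def defectSum : S.Npos × S.Nneg →ₗ[ℂ] S.Hmax.domain :=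
  (S.defectIncl Complex.I).coprod (S.defectIncl (-Complex.I))

@[simp]
theorem coe_defectSum (f : S.Npos × S.Nneg) : (S.defectSum f : S.H) = f.1 + f.2 := rfl

theorem Hmax_defectSum (f : S.Npos × S.Nneg) :
    S.Hmax (S.defectSum f) = Complex.I • ((f.1 : S.H) - f.2) := by
  have h : S.Hmax (S.defectSum f) =
      S.Hmax (S.defectIncl Complex.I f.1) + S.Hmax (S.defectIncl (-Complex.I) f.2) :=
    S.Hmax.map_add _ _
  rw [h, Hmax_defectIncl, Hmax_defectIncl, smul_sub, neg_smul, sub_eq_add_neg]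

/-- Green's formula on `𝒩₊ + 𝒩₋`. -/
theorem wronskian_defectSum (f g : S.Npos × S.Nneg) :
    wronskian (S.bdryB (S.defectSum f)) (S.bdryB (S.defectSum g)) -
        wronskian (S.bdryA (S.defectSum f)) (S.bdryA (S.defectSum g)) =
      -2 * Complex.I * (inner ℂ f.1 g.1 - inner ℂ f.2 g.2) := by
  rw [← inner_Hmax_sub_inner, Hmax_defectSum, Hmax_defectSum]
  simp only [coe_defectSum, inner_smul_left, inner_smul_right, inner_add_left, inner_add_right,
    inner_sub_left, inner_sub_right, Complex.conj_I, Submodule.coe_inner]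
  ring

theorem inner_eq_of_wronskian_eq {f g : S.Npos × S.Nneg}
    (h : wronskian (S.bdryB (S.defectSum f)) (S.bdryB (S.defectSum g)) =
      wronskian (S.bdryA (S.defectSum f)) (S.bdryA (S.defectSum g))) :
    inner ℂ f.1 g.1 = inner ℂ f.2 g.2 := by
  have h' := S.wronskian_defectSum f g
  rw [h, sub_self, eq_comm, mul_eq_zero] at h'
  exact sub_eq_zero.1 (h'.resolve_left (by simp))

/-- The boundary values of elements of `𝒩₊ + 𝒩₋` at both end points. -/
noncomputable def defectBdry : S.Npos × S.Nneg →ₗ[ℂ] (Fin 2 → ℂ) × (Fin 2 → ℂ) :=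
  (S.bdryA.prod S.bdryB) ∘ₗ S.defectSum

/-- If all boundary values vanish, Green's formula gives `⟨f₊,g₊⟩ = ⟨f₋,g₋⟩` for every `g`; testing
with `(f₊, 0)` and `(0, f₋)` kills both components. -/
theorem defectBdry_injective : Function.Injective S.defectBdry := by
  rw [← LinearMap.ker_eq_bot, LinearMap.ker_eq_bot']
  intro f hf
  have hA : S.bdryA (S.defectSum f) = 0 := congrArg Prod.fst hf
  have hB : S.bdryB (S.defectSum f) = 0 := congrArg Prod.snd hf
  have key : ∀ g : S.Npos × S.Nneg, inner ℂ f.1 g.1 = inner ℂ f.2 g.2 := fun g =>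
    S.inner_eq_of_wronskian_eq (by rw [hA, hB]; simp [wronskian])
  refine Prod.ext ?_ ?_
  · simpa using key (f.1, 0)
  · simpa using (key (0, f.2)).symm

/-- An injective map between spaces of dimension `2 + 2` is onto. This is von Neumann's
decomposition of `dom(H_max)`, read off at the boundary. -/
theorem exists_defectSum_bdry_eq (bpos : Module.Basis (Fin 2) ℂ S.Npos)
    (bneg : Module.Basis (Fin 2) ℂ S.Nneg) (g : S.Hmax.domain) :
    ∃ f, S.bdryA (S.defectSum f) = S.bdryA g ∧ S.bdryB (S.defectSum f) = S.bdryB g := by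
  have := bpos.finiteDimensional_of_finite
  have := bneg.finiteDimensional_of_finite
  have hs : Function.Surjective S.defectBdry := by
    refine (LinearMap.injective_iff_surjective_of_finrank_eq_finrank ?_).1 S.defectBdry_injective
    rw [Module.finrank_prod, Module.finrank_eq_card_basis bpos, Module.finrank_eq_card_basis bneg]
    simp
  obtain ⟨f, hf⟩ := hs (S.bdryA g, S.bdryB g)
  exact ⟨f, congrArg Prod.fst hf, congrArg Prod.snd hf⟩

theorem coe_mem_Hmin_domain_iff (f : S.Hmax.domain) :
    (f : S.H) ∈ S.Hmin.domain ↔ S.bdryA f = 0 ∧ S.bdryB f = 0 := by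
  rw [Hmin, LinearPMap.domRestrict_domain]
  simp [Submodule.mem_map]

theorem coe_mem_HAB_domain_iff (A B : Matrix (Fin 2) (Fin 2) ℂ) (f : S.Hmax.domain) :
    (f : S.H) ∈ (S.HAB A B).domain ↔ S.gamma A B f = 0 := by
  rw [HAB, LinearPMap.domRestrict_domain]
  simp [Submodule.mem_map]

theorem HAB_domain_le (A B : Matrix (Fin 2) (Fin 2) ℂ) :
    (S.HAB A B).domain ≤ S.Hmax.domain := by
  rw [HAB, LinearPMap.domRestrict_domain]
  exact inf_le_right

theorem Hmin_domain_le : S.Hmin.domain ≤ S.Hmax.domain := by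
  rw [Hmin, LinearPMap.domRestrict_domain]
  exact inf_le_right

theorem gamma_apply (A B : Matrix (Fin 2) (Fin 2) ℂ) (f : S.Hmax.domain) :
    S.gamma A B f = A *ᵥ S.bdryA f - B *ᵥ S.bdryB f := rfl

/-- The trace map on a defect space as a linear map. -/
noncomputable def gammaDefect (A B : Matrix (Fin 2) (Fin 2) ℂ) (z : ℂ) : S.defect z →ₗ[ℂ] (Fin 2 → ℂ) :=
  S.gamma A B ∘ₗ S.defectIncl z

theorem gamma_defectSum (A B : Matrix (Fin 2) (Fin 2) ℂ) (f : S.Npos × S.Nneg) :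
    S.gamma A B (S.defectSum f) =
      S.gammaDefect A B Complex.I f.1 + S.gammaDefect A B (-Complex.I) f.2 :=
  map_add (S.gamma A B) _ _

/-! ### Von Neumann's unitary. -/

variable {S} {A B : Matrix (Fin 2) (Fin 2) ℂ}

theorem norm_eq_of_gamma_eq_zero (hAB : IsSelfAdjointPair A B) {f : S.Npos × S.Nneg}
    (h : S.gamma A B (S.defectSum f) = 0) : ‖f.1‖ = ‖f.2‖ := by
  have h0 := sub_eq_zero.1 h
  have h1 := S.inner_eq_of_wronskian_eq (wronskian_eq_of_isSelfAdjointPair hAB h0 h0)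
  have h1 := (inner_self_eq_norm_sq_to_K (𝕜 := ℂ) f.1).symm.trans
    (h1.trans (inner_self_eq_norm_sq_to_K (𝕜 := ℂ) f.2))
  exact (sq_eq_sq₀ (norm_nonneg _) (norm_nonneg _)).1 (by exact_mod_cast h1)

/-- A kernel element would be an eigenvector of the symmetric `H_{A,B}` for `i`; the norm identity
with second component zero excludes it. -/
theorem gammaDefect_I_injective (hAB : IsSelfAdjointPair A B) :
    Function.Injective (S.gammaDefect A B Complex.I) := by
  rw [← LinearMap.ker_eq_bot, LinearMap.ker_eq_bot']
  intro f hf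
  have := norm_eq_of_gamma_eq_zero hAB (f := (f, 0)) (by rw [gamma_defectSum, hf]; simp)
  simpa using this

theorem gammaDefect_neg_I_injective (hAB : IsSelfAdjointPair A B) :
    Function.Injective (S.gammaDefect A B (-Complex.I)) := by
  rw [← LinearMap.ker_eq_bot, LinearMap.ker_eq_bot']
  intro f hf
  have := norm_eq_of_gamma_eq_zero hAB (f := (0, f)) (by rw [gamma_defectSum, hf]; simp)
  simpa using this.symm

/-- The right side says only that each `f + U f` satisfies the boundary condition. This already
forces equality of domains, as elements of `dom(H_{A,B})` reduce modulo `dom(H_min)` to `𝒩₊ + 𝒩₋`,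
where `γ` is injective on `𝒩₋`. -/
theorem isVonNeumannUnitary_iff (bpos : Module.Basis (Fin 2) ℂ S.Npos)
    (bneg : Module.Basis (Fin 2) ℂ S.Nneg) (U : S.Npos ≃ₗᵢ[ℂ] S.Nneg)
    (hAB : IsSelfAdjointPair A B) :
    S.IsVonNeumannUnitary A B U ↔
      ∀ f, S.gammaDefect A B (-Complex.I) (U f) = -S.gammaDefect A B Complex.I f := by
  have hmem : ∀ f, ((S.defectSum (f, U f) : S.Hmax.domain) : S.H) ∈ S.vonNeumannSpace U :=
    fun f => ⟨f, rfl⟩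
  constructor
  · rintro ⟨-, h⟩ f
    have h1 : ((S.defectSum (f, U f) : S.Hmax.domain) : S.H) ∈ (S.HAB A B).domain := by
      rw [h]
      exact Submodule.mem_sup_right (hmem f)
    rw [coe_mem_HAB_domain_iff, gamma_defectSum, add_comm] at h1
    exact eq_neg_of_add_eq_zero_left h1
  · intro h
    refine ⟨Submodule.disjoint_def.2 ?_, le_antisymm ?_ (sup_le ?_ ?_)⟩
    · rintro _ hx ⟨f, rfl⟩
      obtain ⟨hA, hB⟩ := (S.coe_mem_Hmin_domain_iff (S.defectSum (f, U f))).1 hx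
      have h0 := S.defectBdry_injective (a₁ := (f, U f)) (a₂ := 0)
        (by rw [map_zero]; exact Prod.ext hA hB)
      rw [show f = 0 from congrArg Prod.fst h0]
      exact map_zero _
    · intro x hx
      lift x to S.Hmax.domain using S.HAB_domain_le A B hx
      rw [coe_mem_HAB_domain_iff] at hx
      -- Subtracting a defect sum with the boundary values of `x` leaves an element of `dom(H_min)`.
      obtain ⟨f, hA, hB⟩ := S.exists_defectSum_bdry_eq bpos bneg x
      have h0 : S.gamma A B (S.defectSum f) = 0 := by rw [gamma_apply, hA, hB, ← gamma_apply, hx]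
      have h2 : f = (f.1, U f.1) := by
        refine Prod.ext rfl (gammaDefect_neg_I_injective hAB ?_)
        rw [h f.1]
        rw [gamma_defectSum, add_comm] at h0
        exact eq_neg_of_add_eq_zero_left h0
      have h3 : (x : S.H) = ((x - S.defectSum f : S.Hmax.domain) : S.H) + S.defectSum f := by
        simp
      rw [h3]
      refine Submodule.add_mem_sup ((S.coe_mem_Hmin_domain_iff _).2 ?_) (h2 ▸ hmem f.1)
      simp only [map_sub, hA, hB, sub_self, and_self]
    · intro x hx
      lift x to S.Hmax.domain using S.Hmin_domain_le hx
      rw [coe_mem_Hmin_domain_iff] at hx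
      simp [coe_mem_HAB_domain_iff, gamma_apply, hx]
    · rintro _ ⟨f, rfl⟩
      refine (S.coe_mem_HAB_domain_iff A B (S.defectSum (f, U f))).2 ?_
      rw [gamma_defectSum, h]
      exact add_neg_cancel _

theorem existsUnique_isVonNeumannUnitary (bpos : Module.Basis (Fin 2) ℂ S.Npos)
    (bneg : Module.Basis (Fin 2) ℂ S.Nneg) (hAB : IsSelfAdjointPair A B) :
    ∃! U : S.Npos ≃ₗᵢ[ℂ] S.Nneg, S.IsVonNeumannUnitary A B U := by
  have := bpos.finiteDimensional_of_finite
  have := bneg.finiteDimensional_of_finite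
  let e1 := LinearEquiv.ofInjectiveOfFinrankEq (S.gammaDefect A B Complex.I)
    (gammaDefect_I_injective hAB) (by simp [Module.finrank_eq_card_basis bpos])
  let e2 := LinearEquiv.ofInjectiveOfFinrankEq (S.gammaDefect A B (-Complex.I))
    (gammaDefect_neg_I_injective hAB) (by simp [Module.finrank_eq_card_basis bneg])
  -- This is `-(γ|𝒩₋)⁻¹ γ|𝒩₊`, the only map with `γ(f + e f) = 0`; the norm identity then makes it
  -- isometric.
  let e := (e1.trans (LinearEquiv.neg ℂ)).trans e2.symm
  have he : ∀ f, S.gammaDefect A B (-Complex.I) (e f) = -S.gammaDefect A B Complex.I f := fun f =>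
    e2.apply_symm_apply _
  have hn : ∀ f, ‖e f‖ = ‖f‖ := fun f =>
    (norm_eq_of_gamma_eq_zero hAB (f := (f, e f))
      (by rw [gamma_defectSum, he]; exact add_neg_cancel _)).symm
  refine ⟨⟨e, hn⟩, (isVonNeumannUnitary_iff bpos bneg _ hAB).2 he, fun V hV => ?_⟩
  refine LinearIsometryEquiv.ext fun f => gammaDefect_neg_I_injective hAB ?_
  rw [(isVonNeumannUnitary_iff bpos bneg _ hAB).1 hV]
  exact (he f).symm

/-! ### The matrix of the unitary. -/

theorem traceMatrix_mulVec {z : ℂ} (w : Fin 2 → S.defect z) (c : Fin 2 → ℂ) :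
    S.traceMatrix A B w *ᵥ c = S.gammaDefect A B z (∑ j, c j • w j) := by
  ext i
  simp only [map_sum, map_smul, Matrix.mulVec, dotProduct, Finset.sum_apply, Pi.smul_apply,
    smul_eq_mul]
  exact Finset.sum_congr rfl fun j _ => mul_comm _ _

theorem isUnit_det_traceMatrix {z : ℂ} (w : Module.Basis (Fin 2) ℂ (S.defect z))
    (h : Function.Injective (S.gammaDefect A B z)) : IsUnit (S.traceMatrix A B w).det := by
  rw [← Matrix.isUnit_iff_isUnit_det, ← Matrix.mulVec_injective_iff_isUnit]
  intro c d hcd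
  rw [traceMatrix_mulVec, traceMatrix_mulVec] at hcd
  simpa only [← w.equivFun_symm_apply, EmbeddingLike.apply_eq_iff_eq] using h hcd

theorem toMatrix_eq (bpos : Module.Basis (Fin 2) ℂ S.Npos)
    (bneg : Module.Basis (Fin 2) ℂ S.Nneg) (hAB : IsSelfAdjointPair A B) (U : S.Npos →ₗ[ℂ] S.Nneg)
    (hU : ∀ f, S.gammaDefect A B (-Complex.I) (U f) = -S.gammaDefect A B Complex.I f) :
    LinearMap.toMatrix bpos bneg U =
      -((S.traceMatrix A B bneg)⁻¹ * S.traceMatrix A B bpos) := by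
  have hu := isUnit_det_traceMatrix bneg (gammaDefect_neg_I_injective hAB)
  have key : S.traceMatrix A B bneg * LinearMap.toMatrix bpos bneg U =
      -S.traceMatrix A B bpos := by
    ext i j
    have h1 := traceMatrix_mulVec (A := A) (B := B) bneg fun k =>
      LinearMap.toMatrix bpos bneg U k j
    simp only [LinearMap.toMatrix_apply, Module.Basis.sum_repr, hU] at h1
    simp only [Matrix.mul_apply, LinearMap.toMatrix_apply]
    exact congrFun h1 i
  rw [← Matrix.mul_neg, ← key, Matrix.nonsing_inv_mul_cancel_left _ _ hu]

/-! ### Boundary value problems and the boundary data map. -/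

variable {z : ℂ}

/-- `r dx` is a finite measure and `y` is bounded, so solutions of the boundary value problem lie in
`L²` automatically. -/
theorem memLp_of_ac {y : ℝ → ℂ} (hy : AbsolutelyContinuousOnInterval y S.a S.b) :
    MemLp y 2 S.μ := by
  have : IsFiniteMeasure S.μ := isFiniteMeasure_withDensity_ofReal S.r_int.2
  have hc := hy.continuousOn
  obtain ⟨C, hC⟩ := hy.exists_bound
  rw [uIcc_of_le S.hab.le] at hc hC
  refine MemLp.of_bound (C := C) ?_ ?_
  · exact ((hc.mono Ioo_subset_Icc_self).aestronglyMeasurable measurableSet_Ioo).mono_ac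
      (withDensity_absolutelyContinuous _ _)
  · refine (ae_iff_ae_vol S).2 ?_
    filter_upwards [ae_restrict_mem measurableSet_Ioo] with x hx
    exact hC x (Ioo_subset_Icc_self hx)

theorem SolvesBVP.tau_eq {c : Fin 2 → ℂ} {y y1 : ℝ → ℂ} (h : S.SolvesBVP A B z c y y1) :
    S.tau y y1 =ᵐ[S.μ] z • y := by
  refine (ae_iff_ae_vol S).2 ?_
  filter_upwards [h.eqn, S.r_pos] with x hx hr
  have hr' : (S.r x : ℂ) ≠ 0 := by exact_mod_cast hr.ne'
  rw [tau, hx, Pi.smul_apply, smul_eq_mul]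
  field_simp

/-- A solution of the boundary value problem represents an element of `ker(H_max - z I)`. -/
theorem SolvesBVP.exists_isRep {c : Fin 2 → ℂ} {y y1 : ℝ → ℂ} (h : S.SolvesBVP A B z c y y1) :
    ∃ w : S.defect z, S.IsRep w y y1 ∧ S.gammaDefect A B z w = c := by
  have hy := memLp_of_ac h.quasi.ac
  have hrep : S.IsRep (hy.toLp y) y y1 :=
    ⟨h.quasi, hy.coeFn_toLp, (memLp_congr_ae h.tau_eq).2 (hy.const_smul z)⟩
  let f : S.Hmax.domain := ⟨hy.toLp y, y, y1, hrep⟩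
  have hf : (f : S.H) ∈ S.defect z := by
    rw [mem_defect_iff]
    have h1 : S.Hmax f =ᵐ[S.μ] S.tau (rep f) (rep1 f) := MemLp.coeFn_toLp (isRep_rep f).memLp
    refine Lp.ext (h1.trans (((isRep_rep f).tau_eq hrep).trans (h.tau_eq.trans ?_)))
    exact (hrep.ae_eq.symm.const_smul z).trans (Lp.coeFn_smul z (f : S.H)).symm
  exact ⟨⟨f, hf⟩, hrep, (S.gamma_eq_trace A B f hrep).trans h.bc⟩

theorem solvesBVP_rep (w : S.defect z) :
    S.SolvesBVP A B z (S.gammaDefect A B z w) (rep (S.defectIncl z w))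
      (rep1 (S.defectIncl z w)) := by
  have hr := isRep_rep (S.defectIncl z w)
  refine ⟨hr.quasi, ?_, (S.gamma_eq_trace A B _ hr).symm⟩
  have h1 : S.Hmax (S.defectIncl z w) =ᵐ[S.μ] S.tau _ _ := MemLp.coeFn_toLp hr.memLp
  have h2 := h1.symm.trans
    ((S.Hmax_defectIncl z w ▸ Lp.coeFn_smul z (w : S.H)).trans (hr.ae_eq.const_smul z))
  filter_upwards [(ae_iff_ae_vol S).1 h2, S.r_pos] with x hx hpos
  have hr' : (S.r x : ℂ) ≠ 0 := by exact_mod_cast hpos.ne'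
  rw [tau, inv_mul_eq_iff_eq_mul₀ hr', Pi.smul_apply, smul_eq_mul] at hx
  rw [hx]
  ring

/-- Solutions with data `c` correspond to elements of `ker(H_max - z I)` with trace `c`. -/
theorem bvpUniquelySolvable_of_bijective (h : Function.Bijective (S.gammaDefect A B z)) :
    S.BVPUniquelySolvable A B z := by
  intro c
  constructor
  · obtain ⟨w, rfl⟩ := h.2 c
    exact ⟨_, _, solvesBVP_rep w⟩
  · intro y y1 w w1 hy hw
    obtain ⟨f, hf, hfc⟩ := hy.exists_isRep
    obtain ⟨g, hg, hgc⟩ := hw.exists_isRep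
    obtain rfl := h.1 (hfc.trans hgc.symm)
    exact (hf.unique hg).1

/-- With normalized traces, the trace map is the coordinate map of the basis `w`. -/
theorem gammaDefect_bijective_of_traceMatrix_eq_one (w : Module.Basis (Fin 2) ℂ (S.defect z))
    (h : S.traceMatrix A B w = 1) : Function.Bijective (S.gammaDefect A B z) := by
  have : (S.gammaDefect A B z : S.defect z → Fin 2 → ℂ) = w.equivFun := by
    funext f
    rw [← w.sum_equivFun f, ← traceMatrix_mulVec, h, Matrix.one_mulVec, w.sum_equivFun f]
  rw [this]
  exact w.equivFun.bijective

theorem traceMatrix_eq_one {w : Fin 2 → S.defect z} (h0 : S.gammaKer A B (w 0) = ![1, 0])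
    (h1 : S.gammaKer A B (w 1) = ![0, 1]) : S.traceMatrix A B w = 1 := by
  ext i j
  fin_cases j <;> fin_cases i <;> simp [traceMatrix, h0, h1]

theorem boundaryDataMap_eq_traceMatrix {A' B' : Matrix (Fin 2) (Fin 2) ℂ}
    (w : Module.Basis (Fin 2) ℂ (S.defect z)) (h : S.traceMatrix A' B' w = 1)
    (A B : Matrix (Fin 2) (Fin 2) ℂ) :
    S.boundaryDataMap A' B' A B z = S.traceMatrix A B w := by
  have hz := bvpUniquelySolvable_of_bijective (gammaDefect_bijective_of_traceMatrix_eq_one w h)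
  refine Matrix.mulVec_injective (funext fun c => ?_)
  -- By the normalization, the solution with data `c` is the combination of `w` with coefficients
  -- `c`.
  have hs := solvesBVP_rep (A := A') (B := B') (∑ j, c j • w j)
  rw [← traceMatrix_mulVec, h, Matrix.one_mulVec] at hs
  rw [boundaryDataMap_mulVec hz A B hs, traceMatrix_mulVec]
  exact (S.gamma_eq_trace A B _ (isRep_rep _)).symm

end SturmLiouville

theorem mainTheorem5 (S : SturmLiouville)
    (A B : Matrix (Fin 2) (Fin 2) ℂ) (hAB : IsSelfAdjointPair A B)
    (bpos : Module.Basis (Fin 2) ℂ S.Npos) (bneg : Module.Basis (Fin 2) ℂ S.Nneg) :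
    (∃! U : S.Npos ≃ₗᵢ[ℂ] S.Nneg, S.IsVonNeumannUnitary A B U) ∧
    ∀ U : S.Npos ≃ₗᵢ[ℂ] S.Nneg, S.IsVonNeumannUnitary A B U →
      (IsUnit (S.traceMatrix A B bneg).det ∧
        LinearMap.toMatrix bpos bneg U.toLinearEquiv.toLinearMap =
          -((S.traceMatrix A B bneg)⁻¹ * S.traceMatrix A B bpos)) ∧
      ∀ A' B' : Matrix (Fin 2) (Fin 2) ℂ, IsSelfAdjointPair A' B' →
        S.gammaKer A' B' (bpos 0) = ![1, 0] → S.gammaKer A' B' (bpos 1) = ![0, 1] →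
        S.gammaKer A' B' (bneg 0) = ![1, 0] → S.gammaKer A' B' (bneg 1) = ![0, 1] →
        S.BVPUniquelySolvable A' B' Complex.I ∧
        S.BVPUniquelySolvable A' B' (-Complex.I) ∧
        IsUnit (S.boundaryDataMap A' B' A B (-Complex.I)).det ∧
        LinearMap.toMatrix bpos bneg U.toLinearEquiv.toLinearMap =
          -((S.boundaryDataMap A' B' A B (-Complex.I))⁻¹ *
            S.boundaryDataMap A' B' A B Complex.I) := by
  refine ⟨SturmLiouville.existsUnique_isVonNeumannUnitary bpos bneg hAB, fun U hU => ?_⟩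
  have hM := SturmLiouville.toMatrix_eq bpos bneg hAB U.toLinearEquiv.toLinearMap
    ((SturmLiouville.isVonNeumannUnitary_iff bpos bneg U hAB).1 hU)
  have hu := SturmLiouville.isUnit_det_traceMatrix bneg
    (SturmLiouville.gammaDefect_neg_I_injective hAB)
  refine ⟨⟨hu, hM⟩, fun A' B' _ hp0 hp1 hn0 hn1 => ?_⟩
  have hp := SturmLiouville.traceMatrix_eq_one hp0 hp1
  have hn := SturmLiouville.traceMatrix_eq_one hn0 hn1
  rw [SturmLiouville.boundaryDataMap_eq_traceMatrix bpos hp,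
    SturmLiouville.boundaryDataMap_eq_traceMatrix bneg hn]
  exact ⟨SturmLiouville.bvpUniquelySolvable_of_bijective
      (SturmLiouville.gammaDefect_bijective_of_traceMatrix_eq_one bpos hp),
    SturmLiouville.bvpUniquelySolvable_of_bijective
      (SturmLiouville.gammaDefect_bijective_of_traceMatrix_eq_one bneg hn), hu, hM⟩
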